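/- Let $A$ be a complete noetherian local ring with maximal ideal $\mathfrak m$, and put $A_i := A/\mathfrak m^{i+1}$ for $i \ge 0$. Let $X$ be a topological space and let $\mathcal M$ be a sheaf of $A$-modules on $X$. Let $\mathcal M_i := A_i \otimes_A \mathcal M$, the sheaf associated to the presheaf $U \mapsto A_i \otimes_A \Gamma(U, \mathcal M)$. Assume that $\mathcal M$ is flat over $A$ (every stalk $\mathcal M_x$ is a flat $A$-module) and $\mathfrak m$-adically complete (the canonical homomorphism $\mathcal M \to \varprojlim_i \mathcal M_i$ is an isomorphism of sheaves), and that the first sheaf cohomology $\mathrm H^1(X, \mathcal M_0)$ vanishes. Then: 1. The $A$-module $\Gamma(X, \mathcal M)$ is $\mathfrak m$-adically free; that is, for some set $Z$ it is isomorphic to the $A$-module $\mathrm F_{\mathrm{dec}}(Z, \widehat A)$ of decaying functions, i.e. functions $f : Z \to \widehat A$ such that for every $i \ge 0$ one has $f(z) \in \mathfrak m^{i+1} \widehat A$ for all but finitely many $z \in Z$. Here $\widehat A$ is the $\mathfrak m$-adic completion of $A$ (canonically isomorphic to $A$). 2. For every $i \ge 0$ the canonical homomorphism $A_i \otimes_A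 \Gamma(X, \mathcal M) \to \Gamma(X, \mathcal M_i)$ is bijective. -/

import Mathlib

open CategoryTheory TopologicalSpace Opposite
open scoped MonoidalCategory TensorProduct

universe u

noncomputable section

namespace AdicSheaf

/-! ### Decaying functions and adically free modules -/

section Modules

variable {A : Type u} [CommRing A] (I : Ideal A)

/-- The `A`-module of decaying functions `f : Z → N`, with respect to the `I`-adic topology of `N`:
for every `i`, all but finitely many values of `f` lie in `I ^ (i + 1) N`
(that is, the set of `z` where the `I`-adic order of `f z` is at most `i` is finite). -/
def decayingFunctions (Z : Type u) (N : Type u) [AddCommGroup N] [Module A N] :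
    Submodule A (Z → N) where
  carrier := {f | ∀ i : ℕ, {z | f z ∉ (I ^ (i + 1) • ⊤ : Submodule A N)}.Finite}
  zero_mem' := by
    intro i
    simp
  add_mem' := by
    intro f g hf hg i
    refine ((hf i).union (hg i)).subset ?_
    intro z hz
    by_contra h
    simp only [Set.mem_union, Set.mem_ofPred_eq, not_or, not_not] at h
    exact hz (Submodule.add_mem _ h.1 h.2)
  smul_mem' := by
    intro a f hf i
    refine (hf i).subset ?_
    intro z hz h
    exact hz (Submodule.smul_mem _ a h)

/-- An `A`-module is `I`-adically free if it is isomorphic to the module of decaying functions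
from some set `Z` to the `I`-adic completion of `A`. -/
def IsAdicallyFree (P : Type u) [AddCommGroup P] [Module A P] : Prop :=
  ∃ Z : Type u, Nonempty (P ≃ₗ[A] decayingFunctions I Z (AdicCompletion I A))

end Modules

/-! ### Sheaves of modules on a topological space -/

/-- The category of sheaves of `A`-modules on the topological space `X`. -/
abbrev ModSheaf (A : Type u) [CommRing A] (X : TopCat.{u}) :=
  Sheaf (Opens.grothendieckTopology X) (ModuleCat.{u} A)

section Sheaves

variable {A : Type u} [CommRing A] {X : TopCat.{u}}

/-- A sheaf of `A`-modules is flat if all its stalks are flat `A`-modules. -/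
def IsFlat (M : ModSheaf A X) : Prop :=
  ∀ x : X, Module.Flat A (TopCat.Presheaf.stalk (C := ModuleCat.{u} A) (X := X) M.obj x)

/-- The global sections of a sheaf of `A`-modules. -/
abbrev globalSections (M : ModSheaf A X) : ModuleCat.{u} A :=
  M.obj.obj (op ⊤)

/-- The presheaf `U ↦ N ⊗ Γ(U, M)`, functorially in the `A`-module `N`. -/
abbrev tensorPresheaf (M : ModSheaf A X) :
    ModuleCat.{u} A ⥤ (Opens X)ᵒᵖ ⥤ ModuleCat.{u} A :=
  MonoidalCategory.curriedTensor (ModuleCat.{u} A) ⋙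
    (Functor.whiskeringLeft _ _ _).obj M.obj

/-- The sheaf `N ⊗ M` associated to the presheaf `U ↦ N ⊗ Γ(U, M)`,
functorially in the `A`-module `N`. -/
abbrev tensorSheaf (M : ModSheaf A X) : ModuleCat.{u} A ⥤ ModSheaf A X :=
  tensorPresheaf M ⋙ presheafToSheaf (Opens.grothendieckTopology X) (ModuleCat.{u} A)

variable (I : Ideal A)

/-- The inverse system of `A`-modules `i ↦ A_i = A ⧸ I ^ (i + 1)`, with the projections as
transition maps. -/
def quotientTower : ℕᵒᵖ ⥤ ModuleCat.{u} A where
  obj i := ModuleCat.of A (A ⧸ I ^ (i.unop + 1))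
  map {i j} f := ModuleCat.ofHom
    (Submodule.factor (Ideal.pow_le_pow_right (Nat.succ_le_succ (leOfHom f.unop))))
  map_id i := by
    ext
    rfl
  map_comp f g := by
    ext
    rfl

/-- The compatible projections `A → A_i`. -/
def toQuotientTower :
    (Functor.const ℕᵒᵖ).obj (𝟙_ (ModuleCat.{u} A)) ⟶ quotientTower I where
  app i := ModuleCat.ofHom (Submodule.mkQ (I ^ (i.unop + 1)))
  naturality i j f := by
    ext
    rfl

/-- The inverse system of sheaves `i ↦ M_i = A_i ⊗ M`. -/
def reductionTower (M : ModSheaf A X) : ℕᵒᵖ ⥤ ModSheaf A X :=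
  quotientTower I ⋙ tensorSheaf M

/-- The sheaf `M_i = A_i ⊗ M`, where `A_i = A ⧸ I ^ (i + 1)`. -/
abbrev reduction (M : ModSheaf A X) (i : ℕ) : ModSheaf A X :=
  (reductionTower I M).obj (op i)

/-- The canonical isomorphism of presheaves `M ≅ A ⊗ M`, given by `m ↦ 1 ⊗ m`. -/
def unitIso (M : ModSheaf A X) : M.obj ≅ (tensorPresheaf M).obj (𝟙_ (ModuleCat.{u} A)) :=
  NatIso.ofComponents (fun U => (λ_ (M.obj.obj U)).symm)
    (fun f => (MonoidalCategory.leftUnitor_inv_naturality (M.obj.map f)))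

/-- The canonical homomorphism of sheaves `M → M_i`, given on sections by `m ↦ 1 ⊗ m`. -/
def toReduction (M : ModSheaf A X) (i : ℕ) : M ⟶ reduction I M i :=
  ⟨(unitIso M).hom ≫ (tensorPresheaf M).map ((toQuotientTower I).app (op i)) ≫
    toSheafify (Opens.grothendieckTopology X)
      ((tensorPresheaf M).obj ((quotientTower I).obj (op i)))⟩

/-- The compatible family of the canonical homomorphisms `M → M_i`. -/
def toReductionCone (M : ModSheaf A X) : Limits.Cone (reductionTower I M) where
  pt := M
  π :=
    { app i := toReduction I M i.unop
      naturality i j f := by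
        apply Sheaf.hom_ext
        have h := (toQuotientTower I).naturality f
        simp only [Functor.const_obj_map] at h
        simp only [Functor.const_obj_map, Category.id_comp, Functor.const_obj_obj]
        change _ = ((unitIso M).hom ≫ (tensorPresheaf M).map ((toQuotientTower I).app i) ≫
          toSheafify _ _) ≫ sheafifyMap _ ((tensorPresheaf M).map ((quotientTower I).map f))
        rw [Category.assoc, Category.assoc, ← toSheafify_naturality, ← Functor.map_comp_assoc,
          ← h]
        rfl }

/-- The `I`-adic completion of `M`: the inverse limit of the sheaves `M_i`. -/
def completion (M : ModSheaf A X) : ModSheaf A X :=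
  Limits.limit (reductionTower I M)

/-- The canonical homomorphism from a sheaf to its `I`-adic completion. -/
def toCompletion (M : ModSheaf A X) : M ⟶ completion I M :=
  Limits.limit.lift (reductionTower I M) (toReductionCone I M)

/-- A sheaf is `I`-adically complete if the canonical homomorphism to its `I`-adic completion is an
isomorphism. -/
def IsAdicallyComplete (M : ModSheaf A X) : Prop :=
  IsIso (toCompletion I M)

/-- The canonical homomorphism `A_i ⊗ Γ(X, M) → Γ(X, M_i)`. -/
def globalReduction (M : ModSheaf A X) (i : ℕ) :
    (A ⧸ I ^ (i + 1)) ⊗[A] globalSections M →ₗ[A] globalSections (reduction I M i) :=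
  ((toSheafify (Opens.grothendieckTopology X)
    ((tensorPresheaf M).obj ((quotientTower I).obj (op i)))).app (op ⊤)).hom

/-- The sheaf of abelian groups underlying a sheaf of `A`-modules. -/
def underlyingAb (M : ModSheaf A X) :
    Sheaf (Opens.grothendieckTopology X) AddCommGrpCat.{u} :=
  (sheafCompose (Opens.grothendieckTopology X)
    (forget₂ (ModuleCat.{u} A) AddCommGrpCat.{u})).obj M

/-- For a sheaf `N` of abelian groups on `X`, the space `X` is `N`-simply connected if the first
sheaf cohomology `H¹(X, N)` vanishes. -/
def IsSimplyConnectedFor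
    (N : Sheaf (Opens.grothendieckTopology X) AddCommGrpCat.{u}) : Prop :=
  Subsingleton (Sheaf.H.{u} N 1)

end Sheaves

end AdicSheaf

end

/-! ### Completions of free modules and decaying functions -/

section Completion

variable {A : Type*} [CommRing A] (I : Ideal A)
  {F : Type*} [AddCommGroup F] [Module A F] {P : Type*} [AddCommGroup P] [Module A P]

/-! Write `k` for the residue field. Flatness makes `N ↦ N ⊗ M` exact, so facts about `k` spread to
every `N` of finite length by dévissage. Vanishing of `H¹(X, N ⊗ M)` spreads in this way, so each
`Γ(X, M_{i+1}) → Γ(X, M_i)` is surjective, and completeness makes `Γ(X, M) → Γ(X, M_0)` surjective.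
Lifting a `k`-basis `Z` of `Γ(X, M_0)` gives a map `ψ` from the free module `F` on `Z` to `Γ(X, M)`.
The comparison `N ⊗ F → Γ(X, N ⊗ M)` is bijective for `N = k` by construction, hence for all `N` of
finite length (`bijective_comparison_of_isFiniteLength`). With `N = A_i`, the limit of the `Γ(X,
M_i)` becomes the adic completion of `F`, which is the module of decaying functions on `Z`. Since
the maximal ideal is finitely generated, the kernel of `Γ(X, M) → Γ(X, M_i)` is the adic submodule
of level `i + 1`; this gives the second claim. -/

/-- If `P` is complete with respect to a filtration `K` which induces the `I`-adic filtration on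
`F`, and `F` is dense in `P`, then `P` is the `I`-adic completion of `F`. -/
theorem AdicCompletion.exists_linearEquiv_of_filtration (φ : F →ₗ[A] P) (K : ℕ → Submodule A P)
    (hK : Antitone K) (hφ : ∀ n f, φ f ∈ K n ↔ f ∈ (I ^ n • ⊤ : Submodule A F))
    (hdense : ∀ n x, ∃ f, x - φ f ∈ K n)
    (hsep : ∀ x, (∀ n, x ∈ K n) → x = 0)
    (hcomp : ∀ x : ℕ → P, (∀ n, x (n + 1) - x n ∈ K n) → ∃ y, ∀ n, y - x n ∈ K n) :
    ∃ e : P ≃ₗ[A] AdicCompletion I F, ∀ n x, x ∈ K n ↔ (e x).val n = 0 := by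
  -- Injectivity is the induced-filtration hypothesis, surjectivity is density; the inverses
  -- assemble into the map to the completion.
  have hb (n : ℕ) : Function.Bijective
      ((I ^ n • ⊤ : Submodule A F).mapQ (K n) φ (fun f hf ↦ (hφ n f).2 hf)) := by
    constructor
    · rw [injective_iff_map_eq_zero]
      intro a ha
      obtain ⟨f, rfl⟩ := Submodule.mkQ_surjective _ a
      simp only [Submodule.mkQ_apply, Submodule.mapQ_apply, Submodule.Quotient.mk_eq_zero] at ha ⊢
      exact (hφ n f).1 ha
    · intro b
      obtain ⟨x, rfl⟩ := Submodule.mkQ_surjective _ b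
      obtain ⟨f, hf⟩ := hdense n x
      refine ⟨Submodule.Quotient.mk f, ?_⟩
      simp only [Submodule.mkQ_apply, Submodule.mapQ_apply]
      exact ((Submodule.Quotient.eq _).2 hf).symm
  let g (n : ℕ) : P →ₗ[A] F ⧸ (I ^ n • ⊤ : Submodule A F) :=
    (LinearEquiv.ofBijective _ (hb n)).symm.toLinearMap ∘ₗ (K n).mkQ
  have hg (n : ℕ) (x : P) (f : F) : g n x = Submodule.Quotient.mk f ↔ x - φ f ∈ K n := by
    simp only [g, LinearMap.comp_apply, LinearEquiv.coe_coe]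
    rw [LinearEquiv.symm_apply_eq, LinearEquiv.ofBijective_apply, Submodule.mapQ_apply,
      Submodule.mkQ_apply, Submodule.Quotient.eq]
  have hg0 (n : ℕ) (x : P) : g n x = 0 ↔ x ∈ K n := by
    rw [← Submodule.Quotient.mk_zero, hg, φ.map_zero, sub_zero]
  let L : P →ₗ[A] AdicCompletion I F := AdicCompletion.lift I g (by
    intro m n hmn
    ext x
    obtain ⟨f, hf⟩ := hdense n x
    rw [LinearMap.comp_apply, (hg n x f).2 hf]
    exact ((hg m x f).2 (hK hmn hf)).symm)
  have hL (n : ℕ) (x : P) : (L x).val n = g n x := rfl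
  refine ⟨LinearEquiv.ofBijective L ⟨?_, ?_⟩, fun n x ↦ ?_⟩
  · rw [injective_iff_map_eq_zero]
    intro x hx
    refine hsep x fun n ↦ ?_
    rw [← hg0, ← hL, hx]
    rfl
  · intro a
    obtain ⟨a, rfl⟩ := AdicCompletion.mk_surjective I F a
    obtain ⟨y, hy⟩ := hcomp (fun n ↦ φ (a n)) (fun n ↦ by
      rw [← map_sub, hφ]
      exact (Submodule.Quotient.eq _).1 (AdicCompletion.AdicCauchySequence.mk_eq_mk n.le_succ a))
    refine ⟨y, AdicCompletion.ext fun n ↦ ?_⟩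
    rw [hL]
    exact (hg n y (a n)).2 (hy n)
  · exact (hg0 n x).symm

/-- In a complete module as in `AdicCompletion.exists_linearEquiv_of_filtration`, the filtration is
the `I`-adic one if `I` is finitely generated. -/
theorem AdicCompletion.exists_linearEquiv_and_filtration_eq (hI : I.FG)
    (φ : F →ₗ[A] P) (K : ℕ → Submodule A P)
    (hK : Antitone K) (hφ : ∀ n f, φ f ∈ K n ↔ f ∈ (I ^ n • ⊤ : Submodule A F))
    (hdense : ∀ n x, ∃ f, x - φ f ∈ K n)
    (hsep : ∀ x, (∀ n, x ∈ K n) → x = 0)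
    (hcomp : ∀ x : ℕ → P, (∀ n, x (n + 1) - x n ∈ K n) → ∃ y, ∀ n, y - x n ∈ K n) :
    Nonempty (P ≃ₗ[A] AdicCompletion I F) ∧ ∀ n, K n = I ^ n • ⊤ := by
  obtain ⟨e, he⟩ := exists_linearEquiv_of_filtration I φ K hK hφ hdense hsep hcomp
  refine ⟨⟨e⟩, fun n ↦ ?_⟩
  have h : K n = (LinearMap.ker (AdicCompletion.eval I F n)).comap e.toLinearMap := by
    ext x
    exact he n x
  -- Finite generation enters here: it makes the kernel of evaluation on the completion equal to `I
  -- ^ n` times the completion.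
  rw [h, ← AdicCompletion.pow_smul_top_eq_ker_eval hI]
  ext x
  rw [Submodule.mem_comap]
  have h2 : (I ^ n • ⊤ : Submodule A (AdicCompletion I F)) =
      (I ^ n • ⊤ : Submodule A P).map e.toLinearMap := by
    rw [Submodule.map_smul'', Submodule.map_top, LinearEquiv.range]
  rw [h2]
  exact e.injective.mem_set_image (s := ((I ^ n • ⊤ : Submodule A P) : Set P))

theorem Finsupp.mem_ideal_smul_top_iff {Z : Type*} (J : Ideal A) (f : Z →₀ A) :
    f ∈ (J • ⊤ : Submodule A (Z →₀ A)) ↔ ∀ z, f z ∈ J := by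
  constructor
  · intro hf z
    have := Submodule.mem_map_of_mem (f := Finsupp.lapply (R := A) z) hf
    rw [Submodule.map_smul''] at this
    simpa using Submodule.smul_mono le_rfl le_top this
  · intro h
    rw [← f.sum_single]
    refine Submodule.sum_mem _ fun z _ ↦ ?_
    have : Finsupp.single z (f z) = f z • Finsupp.single z (1 : A) := by simp
    rw [this]
    exact Submodule.smul_mem_smul (h z) trivial

end Completion

/-- The decaying functions from `Z` to the `I`-adic completion of `A` form the `I`-adic completion
of the free `A`-module on `Z`. -/
theorem AdicSheaf.nonempty_decayingFunctions_linearEquiv {A : Type u} [CommRing A] (I : Ideal A)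
    (hI : I.FG) (Z : Type u) :
    Nonempty (decayingFunctions I Z (AdicCompletion I A) ≃ₗ[A] AdicCompletion I (Z →₀ A)) := by
  classical
  let D := decayingFunctions I Z (AdicCompletion I A)
  have hsm (n : ℕ) (x : AdicCompletion I A) :
      x ∈ (I ^ n • ⊤ : Submodule A (AdicCompletion I A)) ↔ x.val n = 0 := by
    rw [AdicCompletion.pow_smul_top_eq_ker_eval hI]
    rfl
  let φ : (Z →₀ A) →ₗ[A] D := LinearMap.codRestrict _
    (LinearMap.pi fun z ↦ AdicCompletion.of I A ∘ₗ Finsupp.lapply z) (by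
      intro f i
      refine f.hasFiniteSupport.subset fun z hz ↦ ?_
      by_contra h0
      have h0 : f z = 0 := by simpa using h0
      exact hz (by simp [h0]))
  have hφ (f : Z →₀ A) (z : Z) : (φ f).1 z = AdicCompletion.of I A (f z) := rfl
  let K (n : ℕ) : Submodule A D :=
    { carrier := {f | ∀ z, (f.1 z).val n = 0}
      zero_mem' := fun z ↦ rfl
      add_mem' := fun {f g} hf hg z ↦ by
        change (f.1 z).val n + (g.1 z).val n = 0
        rw [hf z, hg z, add_zero]
      smul_mem' := fun a f hf z ↦ by
        change a • (f.1 z).val n = 0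
        rw [hf z, smul_zero] }
  have hK (n : ℕ) (f : D) : f ∈ K n ↔ ∀ z, (f.1 z).val n = 0 := Iff.rfl
  have hval {m n : ℕ} (h : m ≤ n) {x : AdicCompletion I A} (hx : x.val n = 0) : x.val m = 0 := by
    rw [← AdicCompletion.transitionMap_comp_eval_apply I A h, hx, map_zero]
  refine (AdicCompletion.exists_linearEquiv_of_filtration I φ K
    (fun m n h f hf z ↦ hval h (hf z)) (fun n f ↦ ?_) (fun n f ↦ ?_) (fun f hf ↦ ?_)
    (fun x hx ↦ ?_)).elim fun e _ ↦ ⟨e⟩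
  · rw [Finsupp.mem_ideal_smul_top_iff, hK]
    refine forall_congr' fun z ↦ ?_
    rw [hφ, AdicCompletion.of_apply, Submodule.mkQ_apply, Submodule.Quotient.mk_eq_zero]
    simp
  -- Only finitely many values are nonzero modulo `I ^ n`; lifting those and putting `0` elsewhere
  -- gives a finitely supported approximation.
  · have hfin : {z | (f.1 z).val n ≠ 0}.Finite := by
      refine (f.2 n).subset fun z hz h ↦ hz ?_
      exact hval n.le_succ ((hsm _ _).1 h)
    choose r hr using fun z ↦ Submodule.Quotient.mk_surjective _ ((f.1 z).val n)
    refine ⟨Finsupp.onFinset hfin.toFinset (fun z ↦ if (f.1 z).val n ≠ 0 then r z else 0)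
      (fun z hz ↦ ?_), fun z ↦ ?_⟩
    · simp only [Set.Finite.mem_toFinset]
      by_contra h
      exact hz (if_neg h)
    · change (f.1 z).val n - Submodule.Quotient.mk (if (f.1 z).val n ≠ 0 then r z else 0) = 0
      split_ifs with h
      · rw [hr, sub_self]
      · rw [not_not] at h
        rw [h, Submodule.Quotient.mk_zero, sub_zero]
  · ext z : 2
    exact AdicCompletion.ext fun n ↦ hf n z
  · have hx' (z : Z) {m n : ℕ} (h : m ≤ n) : ((x n).1 z).val m = ((x m).1 z).val m := by
      induction n, h using Nat.le_induction with
      | base => rfl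
      | succ n h ih =>
        rw [← ih]
        have := hval h (hx n z)
        exact sub_eq_zero.1 this
    -- The limit is diagonal: its `n`-th component is that of `x n`. Its decay at index `i` concerns
    -- level `i + 1`, so it is inherited from `x (i + 1)`.
    let y (z : Z) : AdicCompletion I A := ⟨fun n ↦ ((x n).1 z).val n, fun {m n} h ↦
      (AdicCompletion.transitionMap_comp_eval_apply I A h _).trans (hx' z h)⟩
    refine ⟨⟨y, fun i ↦ ((x (i + 1)).2 i).subset fun z hz h ↦ hz ?_⟩, fun n z ↦ ?_⟩
    · rw [hsm] at h ⊢
      exact h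
    · change ((x n).1 z).val n - ((x n).1 z).val n = 0
      rw [sub_self]

/-! ### Tensor products with a flat sheaf -/

namespace AdicSheaf

open Limits

variable {A : Type u} [CommRing A] {X : TopCat.{u}}

instance tensorPresheaf_preservesColimitsOfSize (M : ModSheaf A X) :
    PreservesColimitsOfSize.{0, 0} (tensorPresheaf M) where
  preservesColimitsOfShape {J} _ := by
    refine preservesColimitsOfShape_of_evaluation (tensorPresheaf M) J fun U ↦ ?_
    have : PreservesColimitsOfSize.{0, 0} (MonoidalCategory.tensorRight (M.obj.obj U)) :=
      inferInstance
    exact inferInstanceAs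
      (PreservesColimitsOfShape J (MonoidalCategory.tensorRight (M.obj.obj U)))

instance tensorPresheaf_additive (M : ModSheaf A X) : (tensorPresheaf M).Additive where
  map_add {N N' f g} := by
    ext U : 2
    exact MonoidalPreadditive.add_whiskerRight ..

instance tensorSheaf_preservesFiniteColimits (M : ModSheaf A X) :
    PreservesFiniteColimits (tensorSheaf M) where
  preservesFiniteColimits _ _ _ := inferInstance

instance tensorSheaf_additive (M : ModSheaf A X) : (tensorSheaf M).Additive := inferInstance

/-- A section of `N ⊗ M` which vanishes in the stalk at `x` vanishes near `x`. -/
theorem exists_map_eq_zero_of_whiskerLeft_germ_eq_zero (M : ModSheaf A X) (N : ModuleCat.{u} A)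
    {U : Opens X} {x : X} (hx : x ∈ U) (s : ((tensorPresheaf M).obj N).obj (op U))
    (hs : (N ◁ TopCat.Presheaf.germ (C := ModuleCat.{u} A) (X := X) M.obj U x hx) s = 0) :
    ∃ (V : Opens X) (i : V ⟶ U), x ∈ V ∧ ((tensorPresheaf M).obj N).map i.op s = 0 := by
  let G := (OpenNhds.inclusion x).op ⋙ M.obj
  -- The stalk is a filtered colimit, tensoring preserves it, and an element that dies in a filtered
  -- colimit dies at some stage.
  have hc := isColimitOfPreserves (MonoidalCategory.tensorLeft N) (colimit.isColimit G)
  let i₀ : (OpenNhds x)ᵒᵖ := op ⟨U, hx⟩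
  let s' : ToType ((G ⋙ MonoidalCategory.tensorLeft N).obj i₀) := s
  have hs' : ((MonoidalCategory.tensorLeft N).mapCocone (colimit.cocone G)).ι.app i₀ s' = 0 := hs
  obtain ⟨k, f, g, h⟩ := Concrete.isColimit_exists_of_rep_eq (G ⋙ MonoidalCategory.tensorLeft N)
    hc s' (0 : ToType ((G ⋙ MonoidalCategory.tensorLeft N).obj i₀))
    (hs'.trans (map_zero _).symm)
  refine ⟨k.unop.1, f.unop, k.unop.2, ?_⟩
  exact h.trans (map_zero _)

/-- Tensoring with a flat sheaf sends injective maps to locally injective maps. -/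
theorem isLocallyInjective_tensorPresheaf_map (M : ModSheaf A X) (hM : IsFlat M)
    {N N' : ModuleCat.{u} A} (f : N ⟶ N') (hf : Function.Injective f) :
    Presheaf.IsLocallyInjective (Opens.grothendieckTopology X) ((tensorPresheaf M).map f) where
  equalizerSieve_mem {U} s t hst := by
    induction U with | op U
    intro x hx
    have := hM x
    let g := TopCat.Presheaf.germ (C := ModuleCat.{u} A) (X := X) M.obj U x hx
    have hinj : Function.Injective
        (f ▷ TopCat.Presheaf.stalk (C := ModuleCat.{u} A) (X := X) M.obj x) :=
      Module.Flat.rTensor_preserves_injective_linearMap f.hom hf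
    have h1 : (f ▷ M.obj.obj (op U)) (s - t) = 0 := by
      rw [map_sub, sub_eq_zero]
      exact hst
    -- Flatness of the stalk allows this to be tested after applying `f`, where it follows from the
    -- interchange law.
    have h2 : (N ◁ g) (s - t) = 0 := by
      apply hinj
      rw [map_zero, ← ConcreteCategory.comp_apply, MonoidalCategory.whisker_exchange,
        ConcreteCategory.comp_apply, h1, map_zero]
    obtain ⟨V, i, hV, h⟩ := exists_map_eq_zero_of_whiskerLeft_germ_eq_zero M N hx _ h2
    refine ⟨V, i, ?_, hV⟩
    rw [map_sub, sub_eq_zero] at h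
    exact h

theorem isLocallyInjective_tensorSheaf_map (M : ModSheaf A X) (hM : IsFlat M)
    {N N' : ModuleCat.{u} A} (f : N ⟶ N') (hf : Function.Injective f) :
    Sheaf.IsLocallyInjective ((tensorSheaf M).map f) :=
  (Presheaf.isLocallyInjective_presheafToSheaf_map_iff _ _).2
    (isLocallyInjective_tensorPresheaf_map M hM f hf)

/-- Right exactness of the tensor product gives surjectivity on every open set, before
sheafification. -/
theorem isLocallySurjective_tensorSheaf_map (M : ModSheaf A X)
    {N N' : ModuleCat.{u} A} (f : N ⟶ N') (hf : Function.Surjective f) :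
    Sheaf.IsLocallySurjective ((tensorSheaf M).map f) := by
  refine (Presheaf.isLocallySurjective_presheafToSheaf_map_iff _ _).2 ?_
  refine Presheaf.isLocallySurjective_of_surjective _ _ fun U ↦ ?_
  exact LinearMap.rTensor_surjective (M.obj.obj U) (g := f.hom) hf

/-- Tensoring with a flat sheaf is exact. -/
theorem shortExact_map_tensorSheaf (M : ModSheaf A X) (hM : IsFlat M)
    {S : ShortComplex (ModuleCat.{u} A)} (hS : S.ShortExact) :
    (S.map (tensorSheaf M)).ShortExact := by
  have := hS.epi_g
  have := isLocallyInjective_tensorSheaf_map M hM S.f hS.moduleCat_injective_f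
  have := isLocallySurjective_tensorSheaf_map M S.g hS.moduleCat_surjective_g
  exact
    { exact := hS.exact.map_of_epi_of_preservesCokernel (tensorSheaf M) inferInstance inferInstance
      mono_f := Sheaf.mono_of_injective _ ((Sheaf.isLocallyInjective_iff_injective _).1 ‹_›)
      epi_g := Sheaf.epi_of_isLocallySurjective ((tensorSheaf M).map S.g) }

/-- The functor from sheaves of modules to sheaves of abelian groups. -/
abbrev forgetToAb (A : Type u) [CommRing A] (X : TopCat.{u}) :
    ModSheaf A X ⥤ Sheaf (Opens.grothendieckTopology X) AddCommGrpCat.{u} :=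
  sheafCompose (Opens.grothendieckTopology X) (forget₂ (ModuleCat.{u} A) AddCommGrpCat.{u})

instance forgetToAb_additive : (forgetToAb A X).Additive where
  map_add := by
    intros
    rfl

instance forgetToAb_preservesFiniteLimits : PreservesFiniteLimits (forgetToAb A X) where
  preservesFiniteLimits J _ _ := by
    have h : PreservesLimitsOfShape J
        (sheafToPresheaf (Opens.grothendieckTopology X) (ModuleCat.{u} A) ⋙
          (Functor.whiskeringRight _ _ _).obj (forget₂ (ModuleCat.{u} A) AddCommGrpCat.{u})) :=
      inferInstance
    have h : PreservesLimitsOfShape J (forgetToAb A X ⋙ sheafToPresheaf _ _) := h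
    exact preservesLimitsOfShape_of_reflects_of_preserves (forgetToAb A X) (sheafToPresheaf _ _)

/-- Needed because cohomology is taken in abelian sheaves. Forgetting scalars is left exact, and
local surjectivity depends only on underlying sections. -/
theorem shortExact_map_forgetToAb (M : ModSheaf A X) (hM : IsFlat M)
    {S : ShortComplex (ModuleCat.{u} A)} (hS : S.ShortExact) :
    ((S.map (tensorSheaf M)).map (forgetToAb A X)).ShortExact := by
  have h := shortExact_map_tensorSheaf M hM hS
  have := h.mono_f
  have hs := isLocallySurjective_tensorSheaf_map M S.g hS.moduleCat_surjective_g
  have : Sheaf.IsLocallySurjective ((forgetToAb A X).map ((tensorSheaf M).map S.g)) :=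
    ⟨fun s ↦ hs.imageSieve_mem s⟩
  exact
    { exact := h.exact.map_of_mono_of_preservesKernel (forgetToAb A X) inferInstance inferInstance
      mono_f := inferInstanceAs (Mono ((forgetToAb A X).map (S.map (tensorSheaf M)).f))
      epi_g := Sheaf.epi_of_isLocallySurjective ((forgetToAb A X).map ((tensorSheaf M).map S.g)) }

end AdicSheaf

/-! ### Modules of finite length over a local ring -/

section FiniteLength

variable {A : Type u} [CommRing A] [IsLocalRing A]

/-- Induction on modules of finite length over a local ring: a property of modules which holds for
the zero module, for the residue field, and which is stable under extensions, holds for all modules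
of finite length. -/
theorem IsFiniteLength.induction_of_isLocalRing (P : ModuleCat.{u} A → Prop)
    (iso : ∀ {N N' : ModuleCat.{u} A}, (N ≅ N') → P N → P N')
    (zero : ∀ N : ModuleCat.{u} A, Subsingleton N → P N)
    (residue : P (ModuleCat.of A (A ⧸ IsLocalRing.maximalIdeal A)))
    (ext : ∀ S : ShortComplex (ModuleCat.{u} A), S.ShortExact → P S.X₁ → P S.X₃ → P S.X₂)
    (N : ModuleCat.{u} A) (hN : IsFiniteLength A N) : P N := by
  suffices h : ∀ (N : Type u) [AddCommGroup N] [Module A N], IsFiniteLength A N →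
      P (ModuleCat.of A N) from h N hN
  intro N _ _ hN
  induction hN with
  | @of_subsingleton M _ _ h => exact zero _ h
  | @of_simple_quotient M _ _ N hs _ ih =>
    let S : ShortComplex (ModuleCat.{u} A) :=
      { f := ModuleCat.ofHom N.subtype
        g := ModuleCat.ofHom N.mkQ
        zero := by ext; simp }
    refine ext S (ModuleCat.shortComplex_shortExact S ?_ N.injective_subtype N.mkQ_surjective) ih ?_
    · exact LinearMap.exact_subtype_mkQ N
    -- Over a local ring the only simple module is the residue field.
    · obtain ⟨I, hI, ⟨e⟩⟩ := isSimpleModule_iff_quot_maximal.1 hs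
      obtain rfl := IsLocalRing.eq_maximalIdeal hI
      exact iso e.symm.toModuleIso residue

/-- For `n ≠ 0` the quotient is a noetherian local ring with nilpotent maximal ideal, hence
artinian. For `n = 0` it is zero, so not local, and is treated apart. -/
theorem isFiniteLength_quotient_maximalIdeal_pow [IsNoetherianRing A] (n : ℕ) :
    IsFiniteLength A (A ⧸ IsLocalRing.maximalIdeal A ^ n) := by
  obtain rfl | hn := eq_or_ne n 0
  · have : Subsingleton (A ⧸ IsLocalRing.maximalIdeal A ^ 0) := by
      rw [pow_zero, Ideal.one_eq_top]
      infer_instance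
    exact .of_subsingleton
  have hne : IsLocalRing.maximalIdeal A ^ n ≠ ⊤ := fun h ↦
    (IsLocalRing.maximalIdeal.isMaximal A).ne_top (top_le_iff.1 (h ▸ Ideal.pow_le_self hn))
  have : Nontrivial (A ⧸ IsLocalRing.maximalIdeal A ^ n) := Ideal.Quotient.nontrivial_iff.2 hne
  have : IsLocalRing (A ⧸ IsLocalRing.maximalIdeal A ^ n) :=
    .of_surjective' (Ideal.Quotient.mk _) Ideal.Quotient.mk_surjective
  have : IsArtinianRing (A ⧸ IsLocalRing.maximalIdeal A ^ n) := by
    rw [isArtinianRing_iff_isNilpotent_maximalIdeal]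
    have hle : IsLocalRing.maximalIdeal (A ⧸ IsLocalRing.maximalIdeal A ^ n) ≤
        (IsLocalRing.maximalIdeal A).map (Ideal.Quotient.mk (IsLocalRing.maximalIdeal A ^ n)) := by
      intro x hx
      obtain ⟨a, rfl⟩ := Ideal.Quotient.mk_surjective x
      exact Ideal.mem_map_of_mem _ fun ha ↦ hx (ha.map _)
    refine ⟨n, le_bot_iff.1 ((Ideal.pow_right_mono hle n).trans ?_)⟩
    rw [← Ideal.map_pow, Ideal.map_quotient_self]
  rw [isFiniteLength_iff_isNoetherian_isArtinian]
  exact ⟨inferInstance, isArtinian_of_surjective_algebraMap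
    (S := A) (R := A ⧸ IsLocalRing.maximalIdeal A ^ n) Ideal.Quotient.mk_surjective⟩

/-- A module killed by a maximal ideal `I` is a quotient of a free module by `I` times it. -/
theorem Module.exists_linearCombination_surjective_of_isMaximal {A : Type*} [CommRing A]
    (I : Ideal A) [I.IsMaximal] {V : Type u} [AddCommGroup V] [Module A V]
    (hV : ∀ a ∈ I, ∀ v : V, a • v = 0) :
    ∃ (Z : Type u) (v : Z → V), Function.Surjective (Finsupp.linearCombination A v) ∧
      ∀ f, Finsupp.linearCombination A v f = 0 → ∀ z, f z ∈ I := by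
  have ht : Module.IsTorsionBySet A V I := fun v a ↦ hV a a.2 v
  let _ : Module (A ⧸ I) V := ht.module
  let _ : Field (A ⧸ I) := Ideal.Quotient.field I
  have : IsScalarTower A (A ⧸ I) V := ht.isScalarTower
  -- An `A`-combination of basis vectors depends only on its coefficients modulo `I`.
  let b := Module.Basis.ofVectorSpace (A ⧸ I) V
  have key (f : Module.Basis.ofVectorSpaceIndex (A ⧸ I) V →₀ A) :
      Finsupp.linearCombination A b f =
        Finsupp.linearCombination (A ⧸ I) b (f.mapRange (algebraMap A (A ⧸ I)) (map_zero _)) := by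
    rw [Finsupp.linearCombination_apply, Finsupp.linearCombination_apply,
      Finsupp.sum_mapRange_index (by simp)]
    simp
  refine ⟨_, b, fun v ↦ ?_, fun f hf z ↦ ?_⟩
  · obtain ⟨f, hf⟩ := Finsupp.mapRange_surjective (α := Module.Basis.ofVectorSpaceIndex (A ⧸ I) V)
      (algebraMap A (A ⧸ I)) (map_zero _)
      Ideal.Quotient.mk_surjective (b.repr v)
    refine ⟨f, ?_⟩
    rw [key, hf, b.linearCombination_repr]
  · rw [key] at hf
    have := DFunLike.congr_fun (linearIndependent_iff.1 b.linearIndependent _ hf) z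
    exact Ideal.Quotient.eq_zero_iff_mem.1 this

end FiniteLength

/-! ### Vanishing of cohomology and sections -/

namespace AdicSheaf

section Cohomology

variable {X : TopCat.{u}}
  {S : ShortComplex (Sheaf (Opens.grothendieckTopology X) AddCommGrpCat.{u})}

/-- In the long exact sequence the obstruction to lifting a global section lies in `H¹` of the
kernel. -/
theorem surjective_app_top_of_isSimplyConnectedFor (hS : S.ShortExact)
    (h : IsSimplyConnectedFor S.X₁) : Function.Surjective (S.g.hom.app (op ⊤)) := by
  intro s
  have hT : Limits.IsTerminal (⊤ : Opens X) := Limits.isTerminalTop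
  obtain ⟨t, ht⟩ := Abelian.Ext.covariant_sequence_exact₃ _ hS
    ((Sheaf.H.equiv₀ S.X₃ hT).symm s) (zero_add 1) (h.elim _ _)
  refine ⟨Sheaf.H.equiv₀ S.X₂ hT t, ?_⟩
  rw [Sheaf.H.equiv₀_naturality hT S.g]
  exact (AddEquiv.eq_symm_apply _).1 ht

theorem isSimplyConnectedFor_of_shortExact (hS : S.ShortExact)
    (h₁ : IsSimplyConnectedFor S.X₁) (h₃ : IsSimplyConnectedFor S.X₃) :
    IsSimplyConnectedFor S.X₂ := by
  refine subsingleton_of_forall_eq 0 fun x ↦ ?_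
  obtain ⟨y, rfl⟩ := Abelian.Ext.covariant_sequence_exact₂ _ hS x (h₃.elim _ _)
  rw [h₁.elim y 0, Abelian.Ext.zero_comp]

theorem isSimplyConnectedFor_of_iso
    {F G : Sheaf (Opens.grothendieckTopology X) AddCommGrpCat.{u}} (e : F ≅ G)
    (h : IsSimplyConnectedFor F) : IsSimplyConnectedFor G :=
  have : Subsingleton ((Sheaf.functorH (Opens.grothendieckTopology X) 1).obj F) := h
  ((Sheaf.functorH (Opens.grothendieckTopology X)
    1).mapIso e).symm.addCommGroupIsoToAddEquiv.subsingleton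

end Cohomology

section Sections

variable {A : Type u} [CommRing A] {X : TopCat.{u}} (M : ModSheaf A X)

open Limits

/-- Dévissage: vanishing of `H¹` is stable under extensions by the long exact sequence, and `M_0` is
the case of the residue field. -/
theorem isSimplyConnectedFor_tensorSheaf_of_isFiniteLength [IsLocalRing A] (hM : IsFlat M)
    (h₀ : IsSimplyConnectedFor (underlyingAb (reduction (IsLocalRing.maximalIdeal A) M 0)))
    (N : ModuleCat.{u} A) (hN : IsFiniteLength A N) :
    IsSimplyConnectedFor (underlyingAb ((tensorSheaf M).obj N)) := by
  refine IsFiniteLength.induction_of_isLocalRing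
    (fun N ↦ IsSimplyConnectedFor (underlyingAb ((tensorSheaf M).obj N))) (fun e h ↦ ?_)
    (fun N hN ↦ ?_) ?_ (fun S hS h₁ h₃ ↦ ?_) N hN
  · exact isSimplyConnectedFor_of_iso ((tensorSheaf M ⋙ forgetToAb A X).mapIso e) h
  · exact Sheaf.subsingleton_H_of_isZero
      ((tensorSheaf M ⋙ forgetToAb A X).map_isZero (ModuleCat.isZero_of_subsingleton N)) 1
  · have e : ModuleCat.of A (A ⧸ IsLocalRing.maximalIdeal A ^ (0 + 1)) ≅
        ModuleCat.of A (A ⧸ IsLocalRing.maximalIdeal A) :=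
      (Submodule.quotEquivOfEq _ _ (by rw [zero_add, pow_one])).toModuleIso
    exact isSimplyConnectedFor_of_iso ((tensorSheaf M ⋙ forgetToAb A X).mapIso e) h₀
  · exact isSimplyConnectedFor_of_shortExact (shortExact_map_forgetToAb M hM hS) h₁ h₃

/-- Surjections out of modules of finite length stay surjective on `Γ(X, - ⊗ M)` if `H¹(X, M₀)`
vanishes. -/
theorem surjective_tensorSheaf_map_app_top [IsLocalRing A] (hM : IsFlat M)
    (h₀ : IsSimplyConnectedFor (underlyingAb (reduction (IsLocalRing.maximalIdeal A) M 0)))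
    {N N' : ModuleCat.{u} A} (hN : IsFiniteLength A N) (f : N ⟶ N') (hf : Function.Surjective f) :
    Function.Surjective (((tensorSheaf M).map f).hom.app (op ⊤)) := by
  have hS := LinearMap.shortExact_shortComplexKer (f := f.hom) hf
  exact surjective_app_top_of_isSimplyConnectedFor (shortExact_map_forgetToAb M hM hS)
    (isSimplyConnectedFor_tensorSheaf_of_isFiniteLength M hM h₀ _
      (hN.of_injective (LinearMap.ker f.hom).injective_subtype))

theorem injective_tensorSheaf_map_app_top (hM : IsFlat M)
    {N N' : ModuleCat.{u} A} (f : N ⟶ N') (hf : Function.Injective f) :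
    Function.Injective (((tensorSheaf M).map f).hom.app (op ⊤)) := by
  have := isLocallyInjective_tensorSheaf_map M hM f hf
  exact (Sheaf.isLocallyInjective_iff_injective _).1 this (op ⊤)

/-- Global sections are left exact, and tensoring with `M` is exact. -/
theorem exact_tensorSheaf_map_app_top (hM : IsFlat M)
    {S : ShortComplex (ModuleCat.{u} A)} (hS : S.ShortExact) :
    Function.Exact (((tensorSheaf M).map S.f).hom.app (op ⊤))
      (((tensorSheaf M).map S.g).hom.app (op ⊤)) := by
  have h := shortExact_map_tensorSheaf M hM hS
  have := h.mono_f
  let Γ : ModSheaf A X ⥤ ModuleCat.{u} A :=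
    sheafToPresheaf _ _ ⋙ (evaluation _ _).obj (op ⊤)
  have : Γ.Additive := ⟨rfl⟩
  have : PreservesFiniteLimits Γ := comp_preservesFiniteLimits _ _
  have h2 := h.exact.map_of_mono_of_preservesKernel Γ inferInstance inferInstance
  exact (ShortComplex.ShortExact.moduleCat_exact_iff_function_exact _).1 h2

/-- An element `a` of `A` which kills `N` kills the sections of `N ⊗ M`. -/
theorem smul_tensorSheaf_app_top_eq_zero (N : ModuleCat.{u} A) (a : A) (ha : ∀ n : N, a • n = 0)
    (s : ((tensorSheaf M).obj N).obj.obj (op ⊤)) : a • s = 0 := by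
  let P := (tensorPresheaf M).obj N
  let μ (Q : (Opens X)ᵒᵖ ⥤ ModuleCat.{u} A) : Q ⟶ Q :=
    { app U := ModuleCat.ofHom (LinearMap.lsmul A (Q.obj U) a)
      naturality U V f := by
        ext x
        exact ((Q.map f).hom.map_smul a x).symm }
  have h0 : μ P = 0 := by
    ext U x
    change a • x = 0
    induction x using TensorProduct.induction_on with
    | zero => exact smul_zero a
    | tmul n m =>
      rw [TensorProduct.smul_tmul', ha, TensorProduct.zero_tmul]
    | add x y hx hy => rw [smul_add, hx, hy, add_zero]
  -- Multiplication by `a` vanishes on the presheaf, hence on its sheafification by the universal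
  -- property.
  have h1 : μ (sheafify (Opens.grothendieckTopology X) P) = 0 := by
    apply sheafify_hom_ext _ _ _ ((tensorSheaf M).obj N).property
    have : toSheafify (Opens.grothendieckTopology X) P ≫ μ _ = μ P ≫ toSheafify _ P := by
      ext U x
      exact ((toSheafify (Opens.grothendieckTopology X) P).app U).hom.map_smul a x |>.symm
    rw [this, h0, zero_comp, comp_zero]
  have h2 := congr($(h1).app (op ⊤) s)
  exact h2

end Sections

end AdicSheaf

/-! ### Global sections of complete sheaves -/

namespace AdicSheaf

open Limits

variable {A : Type u} [CommRing A] {X : TopCat.{u}} (M : ModSheaf A X) (I : Ideal A)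

section Comparison

variable {F : Type u} [AddCommGroup F] [Module A F] (ψ : F →ₗ[A] globalSections M)

/-- The comparison map `N ⊗ F → Γ(X, N ⊗ M)` induced by a linear map `F → Γ(X, M)`. -/
noncomputable def comparison (N : ModuleCat.{u} A) :
    N ⊗[A] F →ₗ[A] globalSections ((tensorSheaf M).obj N) :=
  ((toSheafify (Opens.grothendieckTopology X) ((tensorPresheaf M).obj N)).app (op ⊤)).hom ∘ₗ
    ψ.lTensor N

theorem comparison_naturality {N N' : ModuleCat.{u} A} (f : N ⟶ N') (t : N ⊗[A] F) :
    comparison M ψ N' (f.hom.rTensor F t) =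
      ((tensorSheaf M).map f).hom.app (op ⊤) (comparison M ψ N t) := by
  have h := congr($(toSheafify_naturality (Opens.grothendieckTopology X)
    ((tensorPresheaf M).map f)).app (op ⊤) (ψ.lTensor N t))
  have h2 : ψ.lTensor N' (f.hom.rTensor F t) = f.hom.rTensor _ (ψ.lTensor N t) :=
    DFunLike.congr_fun
      ((LinearMap.lTensor_comp_rTensor ..).trans (LinearMap.rTensor_comp_lTensor ..).symm) t
  exact (congrArg ((toSheafify (Opens.grothendieckTopology X)
    ((tensorPresheaf M).obj N')).app (op ⊤)) h2).trans h

/-- If the comparison map is bijective for the residue field, then it is so for all modules of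
finite length. -/
theorem bijective_comparison_of_isFiniteLength [IsLocalRing A] (hM : IsFlat M)
    (h₀ : Function.Bijective
      (comparison M ψ ((quotientTower (IsLocalRing.maximalIdeal A)).obj (op 0))))
    (N : ModuleCat.{u} A) (hN : IsFiniteLength A N) : Function.Bijective (comparison M ψ N) := by
  have iso {N N' : ModuleCat.{u} A} (e : N ≅ N') (h : Function.Bijective (comparison M ψ N)) :
      Function.Bijective (comparison M ψ N') := by
    have h1 : comparison M ψ N' ∘ e.toLinearEquiv.rTensor F =
        (((tensorSheaf M ⋙ sheafToPresheaf _ _ ⋙ (evaluation _ _).obj (op ⊤)).mapIso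
          e).toLinearEquiv) ∘ comparison M ψ N :=
      funext fun t ↦ comparison_naturality M ψ e.hom t
    rw [← (e.toLinearEquiv.rTensor F).bijective.of_comp_iff, h1]
    exact (LinearEquiv.bijective _).comp h
  refine IsFiniteLength.induction_of_isLocalRing
    (fun N ↦ Function.Bijective (comparison M ψ N)) iso (fun N hN ↦ ?_) ?_
    (fun S hS h₁ h₃ ↦ ?_) N hN
  · have h1 : Subsingleton (N ⊗[A] F) := by
      refine subsingleton_of_forall_eq 0 fun t ↦ ?_
      induction t using TensorProduct.induction_on with
      | zero => rfl
      | tmul n f => rw [Subsingleton.elim n 0, TensorProduct.zero_tmul]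
      | add x y hx hy => rw [hx, hy, add_zero]
    have h2 : Subsingleton (globalSections ((tensorSheaf M).obj N)) :=
      ModuleCat.subsingleton_of_isZero
        ((tensorSheaf M ⋙ sheafToPresheaf _ _ ⋙ (evaluation _ _).obj (op ⊤)).map_isZero
          (ModuleCat.isZero_of_subsingleton N))
    exact ⟨Function.injective_of_subsingleton _, fun s ↦ ⟨0, Subsingleton.elim _ _⟩⟩
  · have e : ModuleCat.of A (A ⧸ IsLocalRing.maximalIdeal A ^ (0 + 1)) ≅
        ModuleCat.of A (A ⧸ IsLocalRing.maximalIdeal A) :=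
      (Submodule.quotEquivOfEq _ _ (by rw [zero_add, pow_one])).toModuleIso
    exact iso e h₀
  -- The row of tensor products is only right exact and the row of sections only left exact; this
  -- suffices for the chase, so neither flatness of `F` nor `H¹` is needed.
  · have hex : Function.Exact (S.f.hom.rTensor F) (S.g.hom.rTensor F) :=
      rTensor_exact F ((ShortComplex.ShortExact.moduleCat_exact_iff_function_exact _).1 hS.exact)
        hS.moduleCat_surjective_g
    have hsurj : Function.Surjective (S.g.hom.rTensor F) :=
      LinearMap.rTensor_surjective F hS.moduleCat_surjective_g
    have hinj := injective_tensorSheaf_map_app_top M hM S.f hS.moduleCat_injective_f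
    have hex' := exact_tensorSheaf_map_app_top M hM hS
    constructor
    · rw [injective_iff_map_eq_zero]
      intro t ht
      obtain ⟨r, rfl⟩ := (hex t).1 (h₃.1 (by
        rw [comparison_naturality, ht, map_zero, map_zero]))
      rw [comparison_naturality] at ht
      rw [h₁.1 (hinj (ht.trans (map_zero _).symm) |>.trans (map_zero _).symm), map_zero]
    · intro s
      obtain ⟨r, hr⟩ := h₃.2 (((tensorSheaf M).map S.g).hom.app (op ⊤) s)
      obtain ⟨t, rfl⟩ := hsurj r
      rw [comparison_naturality] at hr
      obtain ⟨y, hy⟩ := (hex' (s - comparison M ψ S.X₂ t)).1 (by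
        rw [map_sub, sub_eq_zero]
        exact hr.symm)
      obtain ⟨r, rfl⟩ := h₁.2 y
      refine ⟨t + S.f.hom.rTensor F r, ?_⟩
      rw [map_add, comparison_naturality, hy, add_sub_cancel]

end Comparison

/-- The transition maps `Γ(X, M_{i + 1}) → Γ(X, M_i)`. -/
noncomputable def reductionTransition (i : ℕ) :
    globalSections (reduction I M (i + 1)) →ₗ[A] globalSections (reduction I M i) :=
  (((reductionTower I M).map (homOfLE i.le_succ).op).hom.app (op ⊤)).hom

/-- The maps `Γ(X, M) → Γ(X, M_i)`. -/
noncomputable def toReductionSections (i : ℕ) :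
    globalSections M →ₗ[A] globalSections (reduction I M i) :=
  ((toReduction I M i).hom.app (op ⊤)).hom

theorem reductionTransition_toReductionSections (i : ℕ) (s : globalSections M) :
    reductionTransition M I i (toReductionSections M I (i + 1) s) = toReductionSections M I i s := by
  have h := (toReductionCone I M).w (homOfLE i.le_succ).op
  exact congr($(h).hom.app (op ⊤) s)

/-- Global sections commute with limits of sheaves, so `Γ(X, M)` is the limit of the `Γ(X, M_i)`. -/
theorem existsUnique_toReductionSections_eq (hM : IsAdicallyComplete I M)
    (s : ∀ i, globalSections (reduction I M i))
    (hs : ∀ i, reductionTransition M I i (s (i + 1)) = s i) :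
    ∃! t, ∀ i, toReductionSections M I i t = s i := by
  let Γ : ModSheaf A X ⥤ Type u :=
    sheafToPresheaf _ _ ⋙ (evaluation _ _).obj (op ⊤) ⋙ forget (ModuleCat.{u} A)
  have hc : IsLimit (toReductionCone I M) :=
    have : IsIso ((limit.isLimit (reductionTower I M)).lift (toReductionCone I M)) := hM
    IsLimit.ofPointIso (limit.isLimit _)
  have hΓ := isLimitOfPreserves Γ hc
  let S : (reductionTower I M ⋙ Γ).sections := ⟨fun i ↦ s i.unop, fun {i j} f ↦ by
    obtain ⟨i⟩ := i
    obtain ⟨j⟩ := j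
    have h : j ≤ i := leOfHom f.unop
    obtain rfl : f = (homOfLE h).op := rfl
    induction i, h using Nat.le_induction with
    | base => exact congr($((reductionTower I M ⋙ Γ).map_id (op j)) (s j))
    | succ i h ih =>
      have h1 := (reductionTower I M ⋙ Γ).map_comp (homOfLE i.le_succ).op (homOfLE h).op
      have h2 := congr($h1 (s (i + 1)))
      refine h2.trans ((congrArg ((reductionTower I M ⋙ Γ).map (homOfLE h).op) (hs i)).trans ?_)
      exact ih⟩
  refine ⟨(Types.isLimitEquivSections hΓ).symm S, fun i ↦ ?_, fun t ht ↦ ?_⟩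
  · exact Types.isLimitEquivSections_symm_apply hΓ S (op i)
  · exact (Types.isLimitEquivSections hΓ).injective
      ((Subtype.ext (funext fun i ↦ ht i.unop)).trans (Equiv.apply_symm_apply _ S).symm)

theorem toReductionSections_surjective (hM : IsAdicallyComplete I M)
    (h : ∀ i, Function.Surjective (reductionTransition M I i)) :
    Function.Surjective (toReductionSections M I 0) := by
  intro s
  choose g hg using h
  obtain ⟨t, ht, -⟩ := existsUnique_toReductionSections_eq M I hM (fun i ↦ Nat.rec s g i)
    fun i ↦ hg i _
  exact ⟨t, ht 0⟩

/-- Both this and the next lemma come from `(A ⧸ J) ⊗ F ≅ F ⧸ J F`. -/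
theorem exists_eq_mk_one_tmul (J : Ideal A) {F : Type*} [AddCommGroup F] [Module A F]
    (t : (A ⧸ J) ⊗[A] F) : ∃ f : F, (Submodule.Quotient.mk 1 : A ⧸ J) ⊗ₜ f = t := by
  obtain ⟨f, hf⟩ := Submodule.mkQ_surjective _ (TensorProduct.quotTensorEquivQuotSMul F J t)
  refine ⟨f, (TensorProduct.quotTensorEquivQuotSMul F J).injective ?_⟩
  rw [← hf]
  exact TensorProduct.quotTensorEquivQuotSMul_mk_one_tmul J f

theorem mk_one_tmul_eq_zero_iff (J : Ideal A) {F : Type*} [AddCommGroup F] [Module A F]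
    (f : F) : (Submodule.Quotient.mk 1 : A ⧸ J) ⊗ₜ[A] f = 0 ↔ f ∈ (J • ⊤ : Submodule A F) := by
  rw [← (TensorProduct.quotTensorEquivQuotSMul F J).map_eq_zero_iff,
    ← Submodule.Quotient.mk_eq_zero]
  exact Eq.congr_left (TensorProduct.quotTensorEquivQuotSMul_mk_one_tmul J f)

/-- If the reductions `Γ(X, M) → Γ(X, M_i)` of a complete sheaf restrict to isomorphisms
`A_i ⊗ F ≅ Γ(X, M_i)` on a free module `F`, then `Γ(X, M)` is adically free. -/
theorem isAdicallyFree_globalSections_of_bijective_comparison (hI : I.FG)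
    (hM : IsAdicallyComplete I M) {Z : Type u} (ψ : (Z →₀ A) →ₗ[A] globalSections M)
    (hψ : ∀ i, Function.Bijective (comparison M ψ ((quotientTower I).obj (op i)))) :
    IsAdicallyFree I (globalSections M) ∧ ∀ i, Function.Bijective (globalReduction I M i) := by
  -- `M_n` is the reduction modulo `I ^ (n + 1)`, so the kernels are shifted by one and level `0` is
  -- the whole module.
  let K (n : ℕ) : Submodule A (globalSections M) :=
    match n with
    | 0 => ⊤
    | n + 1 => LinearMap.ker (toReductionSections M I n)
  have hK (n : ℕ) (x) : x ∈ K (n + 1) ↔ toReductionSections M I n x = 0 := Iff.rfl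
  have hsurj (i : ℕ) (s) : ∃ f, toReductionSections M I i (ψ f) = s := by
    obtain ⟨t, rfl⟩ := (hψ i).2 s
    obtain ⟨f, rfl⟩ := exists_eq_mk_one_tmul (I ^ (i + 1)) t
    exact ⟨f, rfl⟩
  have hzero (i : ℕ) (f) : toReductionSections M I i (ψ f) = 0 ↔
      f ∈ (I ^ (i + 1) • ⊤ : Submodule A (Z →₀ A)) := by
    rw [← mk_one_tmul_eq_zero_iff]
    exact ⟨fun h ↦ (hψ i).1 (h.trans (map_zero _).symm),
      fun h ↦ (congrArg (comparison M ψ ((quotientTower I).obj (op i))) h).trans (map_zero _)⟩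
  obtain ⟨⟨e⟩, hKI⟩ := AdicCompletion.exists_linearEquiv_and_filtration_eq I hI ψ K
    (antitone_nat_of_succ_le fun n ↦ by
      cases n with
      | zero => exact le_top
      | succ n =>
        intro x hx
        rw [hK] at hx ⊢
        rw [← reductionTransition_toReductionSections, hx, map_zero])
    (fun n f ↦ by
      cases n with
      | zero => simp [K]
      | succ n => exact hzero n f)
    (fun n x ↦ by
      cases n with
      | zero => exact ⟨0, trivial⟩
      | succ n =>
        obtain ⟨f, hf⟩ := hsurj n (toReductionSections M I n x)
        exact ⟨f, by rw [hK, map_sub, hf, sub_self]⟩)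
    (fun x hx ↦ (existsUnique_toReductionSections_eq M I hM (fun _ ↦ 0)
      fun _ ↦ map_zero _).unique (fun i ↦ hx (i + 1)) fun i ↦ map_zero _)
    (fun x hx ↦ by
      -- The shift in `K` forces `x (i + 1)` at level `i`: it agrees with `x (i + 2)` modulo `K (i +
      -- 1)`.
      obtain ⟨y, hy, -⟩ := existsUnique_toReductionSections_eq M I hM
        (fun i ↦ toReductionSections M I i (x (i + 1))) fun i ↦ by
          rw [reductionTransition_toReductionSections, ← sub_eq_zero, ← map_sub]
          exact hx (i + 1)
      refine ⟨y, fun n ↦ ?_⟩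
      cases n with
      | zero => trivial
      | succ n => rw [hK, map_sub, hy, sub_self])
  obtain ⟨e'⟩ := nonempty_decayingFunctions_linearEquiv I hI Z
  refine ⟨⟨Z, ⟨e.trans e'.symm⟩⟩, fun i ↦ ⟨?_, fun s ↦ ?_⟩⟩
  -- Injectivity says that the kernel of reduction is no larger than `I ^ (i + 1) Γ(X, M)`, which is
  -- `hKI`.
  · rw [injective_iff_map_eq_zero]
    intro t ht
    obtain ⟨x, rfl⟩ := exists_eq_mk_one_tmul (I ^ (i + 1)) t
    rw [mk_one_tmul_eq_zero_iff, ← hKI, hK]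
    exact ht
  · obtain ⟨f, hf⟩ := hsurj i s
    exact ⟨_, hf⟩

end AdicSheaf

/-- The global sections of a flat adically complete sheaf of modules whose special fibre has
vanishing first cohomology are adically free, and are compatible with reduction. -/
theorem theorem5p5 {A : Type u} [CommRing A] [IsLocalRing A] [IsNoetherianRing A]
    [IsAdicComplete (IsLocalRing.maximalIdeal A) A]
    {X : TopCat.{u}} (M : AdicSheaf.ModSheaf A X)
    (hflat : AdicSheaf.IsFlat M)
    (hcomplete : AdicSheaf.IsAdicallyComplete (IsLocalRing.maximalIdeal A) M)
    (hH1 : AdicSheaf.IsSimplyConnectedFor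
      (AdicSheaf.underlyingAb (AdicSheaf.reduction (IsLocalRing.maximalIdeal A) M 0))) :
    AdicSheaf.IsAdicallyFree (IsLocalRing.maximalIdeal A) (AdicSheaf.globalSections M) ∧
      ∀ i : ℕ, Function.Bijective
        (AdicSheaf.globalReduction (IsLocalRing.maximalIdeal A) M i) := by
  set I := IsLocalRing.maximalIdeal A
  have hfin (i : ℕ) : IsFiniteLength A ((AdicSheaf.quotientTower I).obj (op i)) :=
    isFiniteLength_quotient_maximalIdeal_pow (i + 1)
  have hlift := AdicSheaf.toReductionSections_surjective M I hcomplete fun i ↦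
    AdicSheaf.surjective_tensorSheaf_map_app_top M hflat hH1 (hfin (i + 1))
      ((AdicSheaf.quotientTower I).map (homOfLE i.le_succ).op) (Submodule.factor_surjective
        (Ideal.pow_le_pow_right (i + 1).le_succ))
  -- The maximal ideal kills `A_0`, hence `Γ(X, M_0)`, which thus has a basis `v` over the residue
  -- field; `p` lifts it to `Γ(X, M)`.
  obtain ⟨Z, v, hv, hker⟩ := Module.exists_linearCombination_surjective_of_isMaximal I
    (V := AdicSheaf.globalSections (AdicSheaf.reduction I M 0)) fun a ha s ↦ by
      refine AdicSheaf.smul_tensorSheaf_app_top_eq_zero M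
        ((AdicSheaf.quotientTower I).obj (op 0)) a (fun n ↦ ?_) s
      obtain ⟨b, rfl⟩ := Submodule.mkQ_surjective _ n
      refine (Submodule.Quotient.mk_eq_zero (I ^ (0 + 1))).2 ?_
      rw [zero_add, pow_one]
      exact I.mul_mem_right b ha
  choose p hp using fun z ↦ hlift (v z)
  let ψ := Finsupp.linearCombination A p
  have hψ (f : Z →₀ A) : AdicSheaf.toReductionSections M I 0 (ψ f) =
      Finsupp.linearCombination A v f := by
    simp only [ψ, Finsupp.linearCombination_apply, Finsupp.sum, map_sum, map_smul, hp]
  refine AdicSheaf.isAdicallyFree_globalSections_of_bijective_comparison M I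
    (IsNoetherian.noetherian I) hcomplete ψ fun i ↦
    AdicSheaf.bijective_comparison_of_isFiniteLength M ψ hflat ⟨?_, fun s ↦ ?_⟩ _ (hfin i)
  · rw [injective_iff_map_eq_zero]
    intro t ht
    obtain ⟨f, rfl⟩ := AdicSheaf.exists_eq_mk_one_tmul (I ^ (0 + 1)) t
    refine (AdicSheaf.mk_one_tmul_eq_zero_iff _ _).2 ?_
    rw [Finsupp.mem_ideal_smul_top_iff, zero_add, pow_one]
    exact hker f ((hψ f).symm.trans ht)
  · obtain ⟨f, rfl⟩ := hv s
    exact ⟨(Submodule.Quotient.mk 1 : A ⧸ I ^ (0 + 1)) ⊗ₜ f, hψ f⟩
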